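/- There are constants $C_0$ and $n_0$ such that the following holds for every real $C\ge C_0$ and every finite simple graph $G$ with $n\ge n_0$ vertices (where $n \geq 2$), whose edges are colored arbitrarily (the coloring need not be proper). Let $d_v$ denote the degree of a vertex $v$, let $\delta$ be the minimum degree of $G$, and let $\lambda_1$ be the second-smallest eigenvalue, counted with multiplicity, of the normalized Laplacian of $G$, that is, of the matrix $\mathcal L$ with $\mathcal L(u,v)=1$ if $u=v$ and $d_v\ne 0$, $\mathcal L(u,v)=-1/\sqrt{d_v d_u}$ if $u$ and $v$ are adjacent, and $\mathcal L(u,v)=0$ otherwise. If $\delta\ge C\log n$ and each color appears on at most $\delta\lambda_1/2$ edges, then $G$ contains at least $\left\lfloor \frac{\delta\lambda_1}{C\log n}\right\rfloor$ pairwise edge-disjoint rainbow spanning trees, where a rainbow spanning tree is a spanning tree of $G$ whose edges have pairwise different colors. -/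

import Mathlib

namespace SimpleGraph

/-- The normalized Laplacian of a finite simple graph: the entry at `(u, v)` is `1` if `u = v` and
`d_v ≠ 0`, it is `-1 / √(d_v d_u)` if `u` and `v` are adjacent, and `0` otherwise. -/
noncomputable def normLapMatrix {V : Type*} [Fintype V] [DecidableEq V] (G : SimpleGraph V)
    [DecidableRel G.Adj] : Matrix V V ℝ :=
  Matrix.of fun u v =>
    if u = v ∧ G.degree v ≠ 0 then 1
    else if G.Adj u v then -(1 / Real.sqrt ((G.degree v : ℝ) * (G.degree u : ℝ)))
    else 0

theorem isHermitian_normLapMatrix {V : Type*} [Fintype V] [DecidableEq V] (G : SimpleGraph V)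
    [DecidableRel G.Adj] : G.normLapMatrix.IsHermitian := by
  ext u v
  by_cases h : u = v
  · subst h
    simp [normLapMatrix]
  · have h' : ¬ v = u := fun e => h e.symm
    simp [normLapMatrix, h, h', G.adj_comm u v, mul_comm]

/-- `λ₁`, the second-smallest eigenvalue (counted with multiplicity) of the normalized Laplacian of
a graph with at least two vertices. Mathlib lists the eigenvalues of a Hermitian matrix in weakly
decreasing order, with indices `0, …, n - 1`, so that `λ₁` has the index `n - 2`. -/
noncomputable def normLapLambdaOne {V : Type*} [Fintype V] [DecidableEq V] [Nontrivial V]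
    (G : SimpleGraph V) [DecidableRel G.Adj] : ℝ :=
  G.isHermitian_normLapMatrix.eigenvalues₀
    ⟨Fintype.card V - 2, Nat.sub_lt Fintype.card_pos Nat.two_pos⟩

/-- `T` is a rainbow spanning tree of the graph `G` with edge coloring `χ`: it is a tree on the
whole vertex set, all its edges are edges of `G`, and these have pairwise different colors. -/
structure IsRainbowSpanningTree {V K : Type*} {G : SimpleGraph V} (χ : G.EdgeLabeling K)
    (T : SimpleGraph V) : Prop where
  le : T ≤ G
  isTree : T.IsTree
  rainbow : ∀ e f : G.edgeSet, (e : Sym2 V) ∈ T.edgeSet → (f : Sym2 V) ∈ T.edgeSet →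
    χ e = χ f → e = f

end SimpleGraph

/-! Assign every edge independently and uniformly to one of `t = ⌊δλ₁/(C log n)⌋` parts. It suffices
that every part contains a rainbow spanning tree, since the parts are disjoint.

Whether a part has such a tree is decided by a rank condition
(`exists_isTree_injOn_of_crossColors`): every partition of the vertices into `s` classes must be
crossed by at least `s - 1` colors. An edge set minimal with this property is rainbow, because the
number of classes is supermodular.

Write `M = δλ₁/2`, and let `X` be the total degree. Chernoff bounds and a union bound
(`SimpleGraph.exists_balanced_edge_map`) make all cuts, inner edge sets and color classes nearly
proportional in every part. The union over exponentially many vertex sets is affordable because the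
allowed error grows with the size of the set. For cuts that error is relative, since a set `S` of at
most half the volume has at least `M|S|` edges leaving it.

The partition condition (`SimpleGraph.card_quotient_le_card_crossColors`, with numerics in
`sub_two_lt_of_partition_bounds`) has three cases. If `X` clearly exceeds `sδ`, the spectral bound
gives more than `(s - 1)M` crossing edges with room for the sampling errors. Otherwise nearly all
edges cross, and if `λ₁` is clearly below 1, colors of size `M` are too small to cover them with few
colors. If `λ₁` is near 1 there is no slack in counting crossing edges, so colors that do not cross
are counted instead. After merging colors all but one have more than `M/2` edges, and the few inner
edges can hold only a few of them. -/

/-! ### Random splitting and concentration -/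

open Finset in
/-- The moment generating function of the number of elements of `A` that a uniformly random map to
`Fin t` sends to `i`. -/
theorem sum_exp_card_filter_le {E : Type*} [Fintype E] [DecidableEq E] {t : ℕ} (ht : 0 < t)
    (A : Finset E) (i : Fin t) {θ : ℝ} (hθ : |θ| ≤ 1) :
    ∑ f : E → Fin t, Real.exp (θ * #{e ∈ A | f e = i}) ≤
      (t : ℝ) ^ Fintype.card E * Real.exp ((#A : ℝ) / t * (θ + θ ^ 2)) := by
  have ht' : (0 : ℝ) < t := by exact_mod_cast ht
  have h1 : ∀ f : E → Fin t, Real.exp (θ * #{e ∈ A | f e = i}) =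
      ∏ e, (if e ∈ A then (if f e = i then Real.exp θ else 1) else 1) := by
    intro f
    rw [prod_ite_mem, univ_inter, prod_ite, prod_const, prod_const_one, mul_one, ← Real.exp_nat_mul,
      mul_comm]
  have h2 : ∀ e : E, ∑ j : Fin t, (if e ∈ A then (if j = i then Real.exp θ else 1) else 1) ≤
      t * (if e ∈ A then Real.exp ((θ + θ ^ 2) / t) else 1) := by
    intro e
    by_cases he : e ∈ A
    · simp only [he, if_true]
      have h3 : ∀ j : Fin t, (if j = i then Real.exp θ else 1) =
          1 + if j = i then Real.exp θ - 1 else 0 := by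
        intro j; split_ifs <;> ring
      have h4 : Real.exp θ - 1 ≤ θ + θ ^ 2 := by
        have := (abs_le.1 (Real.abs_exp_sub_one_sub_id_le hθ)).2
        linarith
      have h5 := Real.add_one_le_exp ((θ + θ ^ 2) / t)
      calc ∑ j : Fin t, (if j = i then Real.exp θ else 1) = t + (Real.exp θ - 1) := by
            simp [h3, sum_add_distrib]
        _ ≤ t * ((θ + θ ^ 2) / t + 1) := by
            rw [mul_add, mul_div_cancel₀ _ ht'.ne']; linarith
        _ ≤ _ := by gcongr
    · simp [he]
  calc ∑ f : E → Fin t, Real.exp (θ * #{e ∈ A | f e = i})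
      = ∏ e : E, ∑ j : Fin t, (if e ∈ A then (if j = i then Real.exp θ else 1) else 1) := by
        rw [Fintype.prod_sum]; exact sum_congr rfl fun f _ => h1 f
    _ ≤ ∏ e : E, (t * (if e ∈ A then Real.exp ((θ + θ ^ 2) / t) else 1)) :=
        prod_le_prod (fun e _ => sum_nonneg fun j _ => by split_ifs <;> positivity)
          fun e _ => h2 e
    _ = _ := by
        rw [prod_mul_distrib, prod_const, card_univ, prod_ite_mem, univ_inter, prod_const,
          ← Real.exp_nat_mul]
        congr 2; ring

open Finset in
/-- A union bound: some map to `Fin t` splits all sets `A j` of a family almost evenly. -/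
theorem exists_balanced_map {E J : Type*} [Fintype E] [DecidableEq E] [Fintype J] {t : ℕ}
    (ht : 0 < t) (A : J → Finset E) (b : J → ℝ) {η : ℝ} (h0 : 0 < η) (h1 : η ≤ 1)
    (hb : 2 * t * ∑ j, Real.exp (-(η * b j)) < 1) :
    ∃ f : E → Fin t, ∀ j i,
      |(#{e ∈ A j | f e = i} : ℝ) - (#(A j) : ℝ) / t| ≤ η * ((#(A j) : ℝ) / t) + b j := by
  have ht' : (0 : ℝ) < t := by exact_mod_cast ht
  -- Exponential Markov weights: `g < 1` at `θ = η` and `θ = -η` gives the two sides of the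
  -- deviation bound after division by `η`. By the moment bound the average of `g` over `f` is at
  -- most `exp (-η b j)`.
  set g : (E → Fin t) → J → Fin t → ℝ → ℝ := fun f j i θ =>
    Real.exp (θ * #{e ∈ A j | f e = i}) *
      Real.exp (-((#(A j) : ℝ) / t * (θ + η ^ 2)) - η * b j) with hg
  have hgpos : ∀ f j i θ, 0 < g f j i θ := fun f j i θ => by positivity
  have key : ∀ j i θ, |θ| = η → ∑ f, g f j i θ ≤ (t : ℝ) ^ Fintype.card E * Real.exp (-(η * b j)) := by
    intro j i θ hθ
    have hsq : θ ^ 2 = η ^ 2 := by rw [← hθ, sq_abs]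
    rw [hg, ← sum_mul]
    refine (mul_le_mul_of_nonneg_right (sum_exp_card_filter_le ht (A j) i (hθ.trans_le h1))
      (Real.exp_pos _).le).trans ?_
    rw [mul_assoc, ← Real.exp_add, hsq]
    apply le_of_eq
    congr 2; ring
  have hsum : ∑ f, ∑ j, ∑ i, (g f j i η + g f j i (-η)) < ∑ _f : E → Fin t, (1 : ℝ) := by
    calc ∑ f, ∑ j, ∑ i, (g f j i η + g f j i (-η))
        = ∑ j, ∑ i, (∑ f, g f j i η + ∑ f, g f j i (-η)) := by
          rw [sum_comm]; refine sum_congr rfl fun j _ => ?_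
          rw [sum_comm]; refine sum_congr rfl fun i _ => ?_
          rw [sum_add_distrib]
      _ ≤ ∑ j, ∑ _i : Fin t, (2 * ((t : ℝ) ^ Fintype.card E * Real.exp (-(η * b j)))) := by
          refine sum_le_sum fun j _ => sum_le_sum fun i _ => ?_
          have := key j i η (abs_of_pos h0)
          have := key j i (-η) (by rw [abs_neg, abs_of_pos h0])
          linarith
      _ = (t : ℝ) ^ Fintype.card E * (2 * t * ∑ j, Real.exp (-(η * b j))) := by
          simp only [sum_const, card_univ, Fintype.card_fin, nsmul_eq_mul, mul_sum]
          refine sum_congr rfl fun j _ => ?_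
          ring
      _ < (t : ℝ) ^ Fintype.card E * 1 := by gcongr
      _ = _ := by simp
  obtain ⟨f, -, hf⟩ := exists_lt_of_sum_lt hsum
  refine ⟨f, fun j i => ?_⟩
  have hle : g f j i η + g f j i (-η) < 1 :=
    ((single_le_sum (f := fun i => g f j i η + g f j i (-η))
      (fun i _ => (add_pos (hgpos _ _ _ _) (hgpos _ _ _ _)).le) (mem_univ i)).trans
      (single_le_sum (f := fun j => ∑ i, (g f j i η + g f j i (-η)))
      (fun j _ => sum_nonneg fun i _ => (add_pos (hgpos _ _ _ _) (hgpos _ _ _ _)).le)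
      (mem_univ j))).trans_lt hf
  have e1 : g f j i η < 1 := by linarith [hgpos f j i (-η)]
  have e2 : g f j i (-η) < 1 := by linarith [hgpos f j i η]
  simp only [hg, ← Real.exp_add, Real.exp_lt_one_iff] at e1 e2
  rw [abs_le]
  constructor
  · refine le_of_mul_le_mul_left ?_ h0
    nlinarith
  · refine le_of_mul_le_mul_left ?_ h0
    nlinarith

/-! ### Partitions and the existence of a rainbow spanning tree -/

/-- Functions that are constant on the classes of a setoid. -/
def Setoid.constOn {V : Type*} (s : Setoid V) : Submodule ℝ (V → ℝ) where
  carrier := {f | ∀ u v, s u v → f u = f v}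
  add_mem' := fun {f g} hf hg u v h => by simp [hf u v h, hg u v h]
  zero_mem' := fun _ _ _ => rfl
  smul_mem' := fun c f hf u v h => by simp [hf u v h]

theorem Setoid.finrank_constOn {V : Type*} [Finite V] (s : Setoid V) :
    Module.finrank ℝ s.constOn = Nat.card (Quotient s) := by
  classical
  have := Fintype.ofFinite (Quotient s)
  let e : (Quotient s → ℝ) ≃ₗ[ℝ] s.constOn :=
    { toFun := fun g => ⟨fun v => g (Quotient.mk s v), fun u v h => by
        simp only [Quotient.sound (s := s) h]⟩
      map_add' := fun _ _ => rfl
      map_smul' := fun _ _ => rfl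
      invFun := fun f => Quotient.lift f.1 f.2
      left_inv := fun g => by ext q; induction q using Quotient.inductionOn; rfl
      right_inv := fun f => rfl }
  rw [← e.finrank_eq, Module.finrank_fintype_fun_eq_card, Nat.card_eq_fintype_card]

/-- The number of classes is supermodular on the lattice of setoids. -/
theorem Setoid.card_quotient_add_le {V : Type*} [Finite V] (r s : Setoid V) :
    Nat.card (Quotient r) + Nat.card (Quotient s) ≤
      Nat.card (Quotient (r ⊓ s)) + Nat.card (Quotient (r ⊔ s)) := by
  -- Dimension formula for the two function spaces: their sum lies in the space of the meet, their
  -- intersection in that of the join.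
  rw [← finrank_constOn, ← finrank_constOn, ← finrank_constOn, ← finrank_constOn,
    ← Submodule.finrank_sup_add_finrank_inf_eq]
  refine add_le_add (Submodule.finrank_mono (sup_le ?_ ?_)) (Submodule.finrank_mono ?_)
  · exact fun f hf u v h => hf u v h.1
  · exact fun f hf u v h => hf u v h.2
  · rintro f ⟨hr, hs⟩ u v h
    have : r ⊔ s ≤ Setoid.ker f := sup_le (fun u v h => hr u v h) (fun u v h => hs u v h)
    exact this h

/-- The pair `e` joins two different classes of `s`. -/
def Setoid.Crosses {V : Type*} (s : Setoid V) (e : Sym2 V) : Prop :=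
  ¬ (e.map (Quotient.mk s)).IsDiag

theorem Setoid.crosses_mk {V : Type*} (s : Setoid V) (u v : V) :
    s.Crosses s(u, v) ↔ ¬ s u v := by
  simp [Setoid.Crosses, Quotient.eq]

theorem Setoid.crosses_inf {V : Type*} (r s : Setoid V) (e : Sym2 V) :
    (r ⊓ s).Crosses e ↔ r.Crosses e ∨ s.Crosses e := by
  induction e with | _ u v => 
    rw [crosses_mk, crosses_mk, crosses_mk, ← not_and_or]; rfl

theorem Setoid.Crosses.mono {V : Type*} {r s : Setoid V} (h : r ≤ s) {e : Sym2 V}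
    (he : s.Crosses e) : r.Crosses e := by
  induction e with | _ u v => rw [crosses_mk] at he ⊢; exact fun h' => he (h h')

open Classical Finset in
/-- The colors of the edges of `F` that cross `s`. -/
noncomputable def Setoid.crossColors {V κ : Type*} (s : Setoid V) (c : Sym2 V → κ)
    (F : Finset (Sym2 V)) : Finset κ :=
  (F.filter s.Crosses).image c

open Classical Finset in
theorem Setoid.mem_crossColors {V κ : Type*} {s : Setoid V} {c : Sym2 V → κ}
    {F : Finset (Sym2 V)} {k : κ} :
    k ∈ s.crossColors c F ↔ ∃ e ∈ F, s.Crosses e ∧ c e = k := by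
  simp [Setoid.crossColors, and_assoc]

open Classical Finset in
/-- In a minimal edge set satisfying the partition condition the colors are pairwise different. -/
theorem injOn_of_minimal_crossColors {V κ : Type*} [Finite V] (c : Sym2 V → κ)
    (F : Finset (Sym2 V)) (hF : ∀ s : Setoid V, Nat.card (Quotient s) ≤ #(s.crossColors c F) + 1)
    (hmin : ∀ e ∈ F, ∃ s : Setoid V, #(s.crossColors c (F.erase e)) + 1 < Nat.card (Quotient s)) :
    Set.InjOn c F := by
  intro e he f hf hef
  by_contra hne
  -- Erasing `e` breaks the condition at some partition. There the condition was tight, and `e` was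
  -- the only crossing edge of its color.
  have key : ∀ e ∈ F, ∃ s : Setoid V, #(s.crossColors c F) + 1 = Nat.card (Quotient s) ∧
      c e ∈ s.crossColors c F ∧ ∀ g ∈ F, c g = c e → s.Crosses g → g = e := by
    intro e he
    obtain ⟨s, hs⟩ := hmin e he
    have hnot : c e ∉ s.crossColors c (F.erase e) := by
      intro hmem
      have : s.crossColors c F ⊆ s.crossColors c (F.erase e) := by
        intro k hk
        obtain ⟨g, hg, hgc, rfl⟩ := Setoid.mem_crossColors.1 hk
        by_cases hge : g = e
        · rwa [hge]
        · exact Setoid.mem_crossColors.2 ⟨g, mem_erase.2 ⟨hge, hg⟩, hgc, rfl⟩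
      have := card_le_card this
      have := hF s
      omega
    have hsub : s.crossColors c F ⊆ insert (c e) (s.crossColors c (F.erase e)) := by
      intro k hk
      obtain ⟨g, hg, hgc, rfl⟩ := Setoid.mem_crossColors.1 hk
      by_cases hge : g = e
      · rw [hge]; exact mem_insert_self _ _
      · exact mem_insert_of_mem
          (Setoid.mem_crossColors.2 ⟨g, mem_erase.2 ⟨hge, hg⟩, hgc, rfl⟩)
    have h1 := card_le_card hsub
    rw [card_insert_of_notMem hnot] at h1
    have h2 := hF s
    refine ⟨s, by omega, ?_, ?_⟩
    · by_contra h3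
      have : s.crossColors c F ⊆ s.crossColors c (F.erase e) := by
        intro k hk
        rcases mem_insert.1 (hsub hk) with rfl | h
        · exact absurd hk h3
        · exact h
      have := card_le_card this
      omega
    · intro g hg hgc hcr
      by_contra hge
      exact hnot (Setoid.mem_crossColors.2 ⟨g, mem_erase.2 ⟨hge, hg⟩, hcr, hgc⟩)
  obtain ⟨r, hr, hre, hr'⟩ := key e he
  obtain ⟨s, hs, hsf, hs'⟩ := key f hf
  have hinf : (r ⊓ s).crossColors c F ⊆ r.crossColors c F ∪ s.crossColors c F := by
    intro k hk
    obtain ⟨g, hg, hgc, rfl⟩ := Setoid.mem_crossColors.1 hk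
    rw [mem_union, Setoid.mem_crossColors, Setoid.mem_crossColors]
    rcases (Setoid.crosses_inf r s g).1 hgc with h | h
    · exact Or.inl ⟨g, hg, h, rfl⟩
    · exact Or.inr ⟨g, hg, h, rfl⟩
  -- An edge of the common color crossing the join crosses `r` and `s`, so it equals both `e` and
  -- `f`. The color lost here contradicts tightness together with supermodularity.
  have hsup : (r ⊔ s).crossColors c F ⊆ (r.crossColors c F ∩ s.crossColors c F).erase (c e) := by
    intro k hk
    obtain ⟨g, hg, hgc, rfl⟩ := Setoid.mem_crossColors.1 hk
    have h1 : r.Crosses g := hgc.mono le_sup_left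
    have h2 : s.Crosses g := hgc.mono le_sup_right
    refine mem_erase.2 ⟨fun h => hne ?_, mem_inter.2 ⟨Setoid.mem_crossColors.2 ⟨g, hg, h1, rfl⟩,
      Setoid.mem_crossColors.2 ⟨g, hg, h2, rfl⟩⟩⟩
    rw [← hr' g hg h h1, hs' g hg (h.trans hef) h2]
  have h1 := card_le_card hinf
  have h2 := card_le_card hsup
  rw [card_erase_of_mem (mem_inter.2 ⟨hre, hef ▸ hsf⟩)] at h2
  have h3 := card_union_add_card_inter (r.crossColors c F) (s.crossColors c F)
  have h4 := Setoid.card_quotient_add_le r s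
  have h5 := hF (r ⊓ s)
  have h6 := hF (r ⊔ s)
  have h7 : 0 < #(r.crossColors c F ∩ s.crossColors c F) :=
    card_pos.2 ⟨_, mem_inter.2 ⟨hre, hef ▸ hsf⟩⟩
  omega

open Classical Finset in
/-- An edge set that meets every partition into `s` classes in at least `s - 1` colors contains a
rainbow spanning tree. -/
theorem exists_isTree_injOn_of_crossColors {V κ : Type*} [Finite V] [Nonempty V]
    (c : Sym2 V → κ) (F : Finset (Sym2 V))
    (hF : ∀ s : Setoid V, Nat.card (Quotient s) ≤ #(s.crossColors c F) + 1) :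
    ∃ T : SimpleGraph V, T.IsTree ∧ T.edgeSet ⊆ F ∧ Set.InjOn c T.edgeSet := by
  induction F using Finset.strongInduction with
  | H F ih =>
  by_cases h : ∀ e ∈ F, ∃ s : Setoid V, #(s.crossColors c (F.erase e)) + 1 < Nat.card (Quotient s)
  · have hinj := injOn_of_minimal_crossColors c F hF h
    set H : SimpleGraph V := SimpleGraph.fromEdgeSet (F : Set (Sym2 V)) with hH
    have hle : H.edgeSet ⊆ F := by
      rw [hH, SimpleGraph.edgeSet_fromEdgeSet]; exact Set.sdiff_subset
    have hconn : H.Connected := by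
      -- No edge crosses the partition into components, so the condition allows only one component.
      have hempty : H.reachableSetoid.crossColors c F = ∅ := by
        rw [eq_empty_iff_forall_notMem]
        intro k hk
        obtain ⟨e, he, hcr, -⟩ := Setoid.mem_crossColors.1 hk
        induction e with | _ u v =>
        rw [Setoid.crosses_mk] at hcr
        have hne : u ≠ v := fun h => hcr (h ▸ H.reachableSetoid.refl u)
        exact hcr (SimpleGraph.Adj.reachable
          ((SimpleGraph.fromEdgeSet_adj _).2 ⟨he, hne⟩))
      have h1 := hF H.reachableSetoid
      rw [hempty, card_empty, zero_add] at h1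
      have h2 := (Finite.card_le_one_iff_subsingleton).1 h1
      exact (SimpleGraph.connected_iff _).2 ⟨fun u v => Quotient.exact
        (Subsingleton.elim (Quotient.mk H.reachableSetoid u) (Quotient.mk _ v)), inferInstance⟩
    obtain ⟨T, hT, hT'⟩ := hconn.exists_isTree_le
    have hsub : T.edgeSet ⊆ F := (SimpleGraph.edgeSet_mono hT).trans hle
    exact ⟨T, hT', hsub, hinj.mono hsub⟩
  · push Not at h
    obtain ⟨e, he, hs⟩ := h
    obtain ⟨T, h1, h2, h3⟩ := ih _ (erase_ssubset he) hs
    exact ⟨T, h1, h2.trans (coe_subset.2 (erase_subset _ _)), h3⟩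

/-! ### Spectral bounds -/

open Matrix in
/-- A Courant–Fischer bound: if the second-smallest eigenvalue of a symmetric matrix is positive
and `w` spans its kernel, it bounds the quadratic form from below on the complement of `w`. -/
theorem Matrix.IsHermitian.eigenvalues₀_mul_dotProduct_le {n : Type*} [Fintype n] [DecidableEq n]
    {A : Matrix n n ℝ} (hA : A.IsHermitian) (j : Fin (Fintype.card n))
    (hj : (j : ℕ) = Fintype.card n - 2) (hpos : 0 < hA.eigenvalues₀ j) {w : n → ℝ} (hw : w ≠ 0)
    (hAw : A *ᵥ w = 0) {f : n → ℝ} (hf : w ⬝ᵥ f = 0) :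
    hA.eigenvalues₀ j * (f ⬝ᵥ f) ≤ f ⬝ᵥ (A *ᵥ f) := by
  set u : n → n → ℝ := fun i => hA.eigenvectorBasis i with hu
  have hinner : ∀ (i : n) (x : n → ℝ),
      inner ℝ (hA.eigenvectorBasis i) (WithLp.toLp 2 x) = u i ⬝ᵥ x := by
    intro i x
    rw [EuclideanSpace.inner_eq_star_dotProduct, star_trivial, dotProduct_comm]
  have hpars : ∀ x y : n → ℝ, x ⬝ᵥ y = ∑ i, (u i ⬝ᵥ x) * (u i ⬝ᵥ y) := by
    intro x y
    have h := hA.eigenvectorBasis.sum_inner_mul_inner (WithLp.toLp 2 x) (WithLp.toLp 2 y)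
    rw [EuclideanSpace.inner_eq_star_dotProduct, star_trivial, dotProduct_comm] at h
    change _ = x ⬝ᵥ y at h
    rw [← h]
    refine Finset.sum_congr rfl fun i _ => ?_
    rw [real_inner_comm, hinner, hinner]
  have hmul : ∀ (i : n) (x : n → ℝ), u i ⬝ᵥ (A *ᵥ x) = hA.eigenvalues i * (u i ⬝ᵥ x) := by
    intro i x
    rw [dotProduct_mulVec, ← mulVec_transpose]
    have hT : Aᵀ = A := by simpa [conjTranspose_eq_transpose_of_trivial] using hA.eq
    rw [hT, hu, hA.mulVec_eigenvectorBasis i]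
    simp
  set e := Fintype.equivOfCardEq (Fintype.card_fin (Fintype.card n)) (α := Fin _) (β := n) with he
  have hcard : 0 < Fintype.card n := j.pos
  set i₀ : n := e ⟨Fintype.card n - 1, by omega⟩ with hi₀
  have hbig : ∀ i, i ≠ i₀ → hA.eigenvalues₀ j ≤ hA.eigenvalues i := by
    intro i hi
    have h1 : e.symm i ≠ ⟨Fintype.card n - 1, by omega⟩ := fun h =>
      hi (by rw [hi₀, ← h, Equiv.apply_symm_apply])
    have h2 : ((e.symm i : Fin _) : ℕ) ≠ Fintype.card n - 1 := fun h => h1 (Fin.ext h)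
    have h3 := (e.symm i).isLt
    refine hA.eigenvalues₀_antitone (show ((e.symm i : Fin _) : ℕ) ≤ j from ?_)
    rw [hj]
    omega
  -- Eigenvectors of positive eigenvalues are orthogonal to the kernel vector, so `w` is parallel to
  -- `u i₀` and `f` has no component along it.
  have hwi : ∀ i, i ≠ i₀ → u i ⬝ᵥ w = 0 := by
    intro i hi
    have h := hmul i w
    rw [hAw, dotProduct_zero] at h
    exact (mul_eq_zero.1 h.symm).resolve_left (hpos.trans_le (hbig i hi)).ne'
  have hw0 : u i₀ ⬝ᵥ w ≠ 0 := by
    intro h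
    apply hw
    rw [← dotProduct_self_eq_zero, hpars]
    refine Finset.sum_eq_zero fun i _ => ?_
    by_cases hi : i = i₀
    · rw [hi, h, zero_mul]
    · rw [hwi i hi, zero_mul]
  have hf0 : u i₀ ⬝ᵥ f = 0 := by
    rw [hpars, Finset.sum_eq_single i₀ (fun i _ hi => by rw [hwi i hi, zero_mul]) (by simp)] at hf
    exact (mul_eq_zero.1 hf).resolve_left hw0
  rw [hpars f f, hpars f (A *ᵥ f), Finset.mul_sum]
  refine Finset.sum_le_sum fun i _ => ?_
  rw [hmul]
  by_cases hi : i = i₀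
  · rw [hi, hf0]; simp
  · nlinarith [hbig i hi, mul_self_nonneg (u i ⬝ᵥ f)]

namespace SimpleGraph

open Matrix

variable {V : Type*} [Fintype V] [DecidableEq V] (G : SimpleGraph V) [DecidableRel G.Adj]

/-- With `D` the diagonal degree matrix, this is `D^{1/2} 𝓛 D^{1/2} = D - A`, which moves the
spectral gap to the combinatorial Laplacian. -/
theorem normLapMatrix_mulVec_sqrt_mul (hd : ∀ v, 0 < G.degree v) (g : V → ℝ) (u : V) :
    Real.sqrt (G.degree u) * (G.normLapMatrix *ᵥ fun v => Real.sqrt (G.degree v) * g v) u =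
      (G.lapMatrix ℝ *ᵥ g) u := by
  simp only [mulVec, dotProduct, Finset.mul_sum]
  refine Finset.sum_congr rfl fun v _ => ?_
  have hu : (0 : ℝ) < G.degree u := by exact_mod_cast hd u
  have hv : (0 : ℝ) < G.degree v := by exact_mod_cast hd v
  rw [← mul_assoc, ← mul_assoc]
  congr 1
  by_cases h : u = v
  · subst h
    simp [normLapMatrix, lapMatrix, degMatrix, (hd u).ne', Real.mul_self_sqrt hu.le]
  · by_cases ha : G.Adj u v
    · simp only [normLapMatrix, lapMatrix, degMatrix, h, ha, of_apply, false_and, if_false, if_true,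
        Real.sqrt_mul hv.le, Matrix.sub_apply, diagonal_apply_ne _ h, adjMatrix_apply]
      have := Real.sqrt_pos.2 hu
      have := Real.sqrt_pos.2 hv
      field_simp
      simp
    · simp [normLapMatrix, lapMatrix, degMatrix, h, ha]

/-- Substituting `f = D^{1/2} g` turns orthogonality to the kernel vector `D^{1/2} 1` into a zero
degree-weighted mean, and the quadratic form into the Dirichlet form. -/
theorem normLapLambdaOne_mul_sum_le [Nontrivial V] (hd : ∀ v, 0 < G.degree v)
    (hpos : 0 < G.normLapLambdaOne) (g : V → ℝ) (hg : ∑ v, (G.degree v : ℝ) * g v = 0) :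
    G.normLapLambdaOne * ∑ v, (G.degree v : ℝ) * g v ^ 2 ≤
      (∑ u, ∑ v, if G.Adj u v then (g u - g v) ^ 2 else 0) / 2 := by
  have hsq : ∀ v, Real.sqrt (G.degree v) * Real.sqrt (G.degree v) = G.degree v := fun v =>
    Real.mul_self_sqrt (by positivity)
  have hsp : ∀ v, 0 < Real.sqrt (G.degree v) := fun v =>
    Real.sqrt_pos.2 (by exact_mod_cast hd v)
  have h := G.isHermitian_normLapMatrix.eigenvalues₀_mul_dotProduct_le
    ⟨Fintype.card V - 2, Nat.sub_lt Fintype.card_pos Nat.two_pos⟩ rfl hpos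
    (w := fun v => Real.sqrt (G.degree v)) (f := fun v => Real.sqrt (G.degree v) * g v)
    (fun h => by
      obtain ⟨v⟩ : Nonempty V := inferInstance
      exact (hsp v).ne' (congrFun h v))
    (by
      funext u
      have h := G.normLapMatrix_mulVec_sqrt_mul hd (fun _ => 1) u
      rw [lapMatrix_mulVec_const_eq_zero] at h
      simpa [(hsp u).ne'] using h)
    (by
      rw [← hg]
      refine Finset.sum_congr rfl fun v _ => ?_
      rw [← mul_assoc, hsq])
  rw [← lapMatrix_toLinearMap₂' ℝ G g, toLinearMap₂'_apply']
  refine (le_of_eq ?_).trans (h.trans (le_of_eq ?_))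
  · rw [normLapLambdaOne]
    congr 1
    refine Finset.sum_congr rfl fun v _ => ?_
    linear_combination -(g v) ^ 2 * hsq v
  · refine Finset.sum_congr rfl fun v _ => ?_
    rw [← G.normLapMatrix_mulVec_sqrt_mul hd g v]
    ring

/-- The spectral lower bound for the number of edges leaving `S`, in terms of volumes. -/
theorem normLapLambdaOne_mul_vol_le [Nontrivial V] (hd : ∀ v, 0 < G.degree v)
    (hpos : 0 < G.normLapLambdaOne) (S : Finset V) :
    G.normLapLambdaOne * ((∑ v ∈ S, (G.degree v : ℝ)) *
        (∑ v, (G.degree v : ℝ) - ∑ v ∈ S, (G.degree v : ℝ))) ≤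
      (G.interedges S Sᶜ).card * ∑ v, (G.degree v : ℝ) := by
  set X := ∑ v, (G.degree v : ℝ) with hX
  set x := ∑ v ∈ S, (G.degree v : ℝ) with hx
  have hXpos : 0 < X := Finset.sum_pos (fun v _ => by exact_mod_cast hd v) Finset.univ_nonempty
  have hind : ∑ v, (G.degree v : ℝ) * (if v ∈ S then 1 else 0) = x := by
    simp [hx]
  -- The test function is the indicator of `S` minus its degree-weighted mean.
  have h := G.normLapLambdaOne_mul_sum_le hd hpos (fun v => (if v ∈ S then 1 else 0) - x / X) (by
    simp only [mul_sub, Finset.sum_sub_distrib, hind, ← Finset.sum_mul, ← hX]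
    field_simp
    simp)
  have e1 : ∑ v, (G.degree v : ℝ) * ((if v ∈ S then 1 else 0) - x / X) ^ 2 = x * (X - x) / X := by
    have : ∀ v, (G.degree v : ℝ) * ((if v ∈ S then 1 else 0) - x / X) ^ 2 =
        (G.degree v : ℝ) * (if v ∈ S then 1 else 0) * (1 - 2 * (x / X)) +
          G.degree v * (x / X) ^ 2 := by
      intro v; split_ifs <;> ring
    simp only [this, Finset.sum_add_distrib, ← Finset.sum_mul, hind, ← hX]
    field_simp
    ring
  have e2 : (∑ u, ∑ v, if G.Adj u v then (((if u ∈ S then 1 else 0) - x / X) -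
      ((if v ∈ S then 1 else 0) - x / X)) ^ 2 else (0 : ℝ)) / 2 = (G.interedges S Sᶜ).card := by
    have hc : ((G.interedges S Sᶜ).card : ℝ) =
        ∑ u, ∑ v, if (u ∈ S ∧ v ∈ Sᶜ ∧ G.Adj u v) then (1 : ℝ) else 0 := by
      rw [← Fintype.sum_prod_type', Finset.sum_boole]
      congr 2
      ext ⟨u, v⟩
      simp [mem_interedges_iff]
    have hc' : ((G.interedges S Sᶜ).card : ℝ) =
        ∑ u, ∑ v, if (v ∈ S ∧ u ∈ Sᶜ ∧ G.Adj v u) then (1 : ℝ) else 0 := by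
      rw [hc, Finset.sum_comm]
    rw [div_eq_iff two_ne_zero, mul_two]
    nth_rewrite 1 [hc]
    rw [hc', ← Finset.sum_add_distrib]
    refine Finset.sum_congr rfl fun u _ => ?_
    rw [← Finset.sum_add_distrib]
    refine Finset.sum_congr rfl fun v _ => ?_
    rw [sub_sub_sub_cancel_right]
    by_cases ha : G.Adj u v <;> by_cases hu : u ∈ S <;> by_cases hv : v ∈ S <;>
      simp [ha, hu, hv, G.adj_comm v u]
  rw [e1, e2] at h
  rw [← mul_div_assoc, div_le_iff₀ hXpos] at h
  exact h

end SimpleGraph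

/-! ### Cut edges, inner edges and volumes -/

open Classical in
/-- The elements of `F` with exactly one end in `S`. -/
noncomputable def cutEdges {V : Type*} (F : Finset (Sym2 V)) (S : Finset V) : Finset (Sym2 V) :=
  {e ∈ F | ∃ u ∈ S, ∃ v ∉ S, e = s(u, v)}

open Classical in
/-- The elements of `F` with both ends in `S`. -/
noncomputable def innerEdges {V : Type*} (F : Finset (Sym2 V)) (S : Finset V) : Finset (Sym2 V) :=
  {e ∈ F | ∀ v ∈ e, v ∈ S}

open Classical in
theorem cutEdges_subset {V : Type*} (F : Finset (Sym2 V)) (S : Finset V) : cutEdges F S ⊆ F :=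
  Finset.filter_subset _ _

open Classical in
theorem innerEdges_subset {V : Type*} (F : Finset (Sym2 V)) (S : Finset V) :
    innerEdges F S ⊆ F :=
  Finset.filter_subset _ _

open Classical in
theorem innerEdges_mono {V : Type*} {F F' : Finset (Sym2 V)} (h : F ⊆ F') (S : Finset V) :
    innerEdges F S ⊆ innerEdges F' S :=
  Finset.filter_subset_filter _ h

open Finset in
theorem Finset.card_eq_sum_ite_mem {α : Type*} [DecidableEq α] {F E : Finset α} (h : F ⊆ E) :
    #F = ∑ e ∈ E, if e ∈ F then 1 else 0 := by
  rw [← card_filter, filter_mem_eq_inter, inter_eq_right.2 h]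

theorem mk_mem_cutEdges {V : Type*} {F : Finset (Sym2 V)} {S : Finset V} {u v : V} :
    s(u, v) ∈ cutEdges F S ↔ s(u, v) ∈ F ∧ (u ∈ S ∧ v ∉ S ∨ v ∈ S ∧ u ∉ S) := by
  classical
  rw [cutEdges, Finset.mem_filter, and_congr_right_iff]
  intro _
  constructor
  · rintro ⟨a, ha, b, hb, h⟩
    rcases Sym2.eq_iff.1 h with ⟨rfl, rfl⟩ | ⟨rfl, rfl⟩
    · exact Or.inl ⟨ha, hb⟩
    · exact Or.inr ⟨ha, hb⟩
  · rintro (⟨ha, hb⟩ | ⟨ha, hb⟩)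
    · exact ⟨u, ha, v, hb, rfl⟩
    · exact ⟨v, ha, u, hb, Sym2.eq_swap⟩

theorem mk_mem_innerEdges {V : Type*} {F : Finset (Sym2 V)} {S : Finset V} {u v : V} :
    s(u, v) ∈ innerEdges F S ↔ s(u, v) ∈ F ∧ u ∈ S ∧ v ∈ S := by
  classical
  simp [innerEdges]

theorem cutEdges_filter {V : Type*} (F : Finset (Sym2 V)) (S : Finset V) (p : Sym2 V → Prop)
    [DecidablePred p] : cutEdges (F.filter p) S = (cutEdges F S).filter p := by
  classical
  exact Finset.filter_comm _ _ _

theorem innerEdges_filter {V : Type*} (F : Finset (Sym2 V)) (S : Finset V) (p : Sym2 V → Prop)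
    [DecidablePred p] : innerEdges (F.filter p) S = (innerEdges F S).filter p := by
  classical
  exact Finset.filter_comm _ _ _

theorem cutEdges_compl {V : Type*} [Fintype V] [DecidableEq V] (F : Finset (Sym2 V))
    (S : Finset V) : cutEdges F Sᶜ = cutEdges F S := by
  ext e
  induction e with | _ u v =>
  rw [mk_mem_cutEdges, mk_mem_cutEdges]
  simp only [Finset.mem_compl]
  tauto

theorem cutEdges_empty {V : Type*} (F : Finset (Sym2 V)) : cutEdges F ∅ = ∅ := by
  ext e
  induction e with | _ u v => simp [mk_mem_cutEdges]

theorem innerEdges_eq_empty {V : Type*} {F : Finset (Sym2 V)} (hF : ∀ e ∈ F, ¬ e.IsDiag)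
    {S : Finset V} (hS : S.card ≤ 1) : innerEdges F S = ∅ := by
  ext e
  induction e with | _ u v =>
  simp only [mk_mem_innerEdges, Finset.notMem_empty, iff_false]
  rintro ⟨h, hu, hv⟩
  exact hF _ h (Sym2.mk_isDiag_iff.2 (Finset.card_le_one.1 hS u hu v hv))

open Classical Finset in
/-- The class of a setoid as a finset. -/
noncomputable def Setoid.fiber {V : Type*} [Fintype V] (s : Setoid V) (q : Quotient s) : Finset V :=
  {v | Quotient.mk s v = q}

theorem Setoid.mem_fiber {V : Type*} [Fintype V] {s : Setoid V} {q : Quotient s} {v : V} :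
    v ∈ s.fiber q ↔ Quotient.mk s v = q := by
  simp [Setoid.fiber]

theorem Setoid.fiber_nonempty {V : Type*} [Fintype V] {s : Setoid V} (q : Quotient s) :
    (s.fiber q).Nonempty := by
  induction q using Quotient.inductionOn with
  | h v => exact ⟨v, Setoid.mem_fiber.2 rfl⟩

open Classical Finset in
theorem Setoid.sum_card_cutEdges {V : Type*} [Fintype V] (s : Setoid V) (F : Finset (Sym2 V)) :
    ∑ q, #(cutEdges F (s.fiber q)) = 2 * #(F.filter s.Crosses) := by
  simp only [fun q => card_eq_sum_ite_mem (cutEdges_subset F (s.fiber q))]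
  rw [sum_comm, card_filter, mul_sum]
  refine sum_congr rfl fun e he => ?_
  induction e with | _ u v =>
  simp only [mk_mem_cutEdges, he, true_and, Setoid.mem_fiber, Setoid.crosses_mk]
  by_cases h : Quotient.mk s u = Quotient.mk s v
  · have h' : s u v := Quotient.exact h
    simp [h, h']
  · have h' : ¬ s u v := fun h' => h (Quotient.sound h')
    have : ∀ q, (if (Quotient.mk s u = q ∧ ¬ Quotient.mk s v = q ∨
        Quotient.mk s v = q ∧ ¬ Quotient.mk s u = q) then 1 else 0) =
        (if Quotient.mk s u = q then 1 else 0) + (if Quotient.mk s v = q then 1 else 0) := by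
      intro q
      by_cases h1 : Quotient.mk s u = q <;> by_cases h2 : Quotient.mk s v = q
      · exact absurd (h1.trans h2.symm) h
      all_goals simp [h1, h2]
    simp [this, sum_add_distrib, h']

open Classical Finset in
theorem Setoid.sum_card_innerEdges {V : Type*} [Fintype V] (s : Setoid V) (F : Finset (Sym2 V)) :
    ∑ q, #(innerEdges F (s.fiber q)) = #(F.filter fun e => ¬ s.Crosses e) := by
  simp only [fun q => card_eq_sum_ite_mem (innerEdges_subset F (s.fiber q))]
  rw [sum_comm, card_filter]
  refine sum_congr rfl fun e he => ?_
  induction e with | _ u v =>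
  simp only [mk_mem_innerEdges, he, true_and, Setoid.mem_fiber, Setoid.crosses_mk, not_not]
  by_cases h : Quotient.mk s u = Quotient.mk s v
  · have h' : s u v := Quotient.exact h
    simp [h, h']
  · have h' : ¬ s u v := fun h' => h (Quotient.sound h')
    have : ∀ q, ¬ (Quotient.mk s u = q ∧ Quotient.mk s v = q) :=
      fun q hq => h (hq.1.trans hq.2.symm)
    simp [this, h']

namespace SimpleGraph

variable {V : Type*} [Fintype V] [DecidableEq V] (G : SimpleGraph V) [DecidableRel G.Adj]

open Finset in
theorem sum_degree_eq_two_mul_card_innerEdges_add (S : Finset V) :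
    ∑ v ∈ S, G.degree v = 2 * #(innerEdges G.edgeFinset S) + #(cutEdges G.edgeFinset S) := by
  have h2 : ∀ v, G.degree v = ∑ e ∈ G.edgeFinset, if v ∈ e then 1 else 0 := by
    intro v
    rw [← card_filter, ← G.card_incidenceFinset_eq_degree, G.incidenceFinset_eq_filter]
  rw [card_eq_sum_ite_mem (innerEdges_subset G.edgeFinset S),
    card_eq_sum_ite_mem (cutEdges_subset G.edgeFinset S), mul_sum, ← sum_add_distrib]
  simp only [h2]
  rw [sum_comm]
  refine sum_congr rfl fun e he => ?_
  induction e with | _ u v =>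
  have hne : u ≠ v := G.ne_of_adj (by simpa using he)
  simp only [mk_mem_innerEdges, mk_mem_cutEdges, he, true_and]
  have : ∀ w, (if w ∈ s(u, v) then 1 else 0) = (if w = u then 1 else 0) + if w = v then 1 else 0 := by
    intro w
    by_cases h1 : w = u <;> by_cases h2 : w = v
    · exact absurd (h1.symm.trans h2) hne
    all_goals simp_all
  simp only [this, sum_add_distrib, sum_ite_eq']
  by_cases hu : u ∈ S <;> by_cases hv : v ∈ S <;> simp [hu, hv]

open Finset in
theorem card_interedges_compl (S : Finset V) :
    #(G.interedges S Sᶜ) = #(cutEdges G.edgeFinset S) := by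
  refine card_nbij (fun p => s(p.1, p.2)) ?_ ?_ ?_
  · rintro ⟨u, v⟩ h
    obtain ⟨hu, hv, ha⟩ := G.mem_interedges_iff.1 h
    refine mem_coe.2 (mk_mem_cutEdges.2 ?_)
    exact ⟨by simpa using ha, Or.inl ⟨hu, mem_compl.1 hv⟩⟩
  · rintro ⟨u, v⟩ h ⟨u', v'⟩ h' heq
    obtain ⟨hu, hv, -⟩ := G.mem_interedges_iff.1 h
    obtain ⟨hu', hv', -⟩ := G.mem_interedges_iff.1 h'
    rcases Sym2.eq_iff.1 heq with ⟨rfl, rfl⟩ | ⟨rfl, rfl⟩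
    · rfl
    · exact absurd hu (mem_compl.1 hv')
  · intro e he
    induction e with | _ u v =>
    obtain ⟨h, h'⟩ := mk_mem_cutEdges.1 (mem_coe.1 he)
    have ha : G.Adj u v := by simpa using h
    rcases h' with ⟨hu, hv⟩ | ⟨hu, hv⟩
    · exact ⟨(u, v), mem_coe.2 (G.mem_interedges_iff.2 ⟨hu, mem_compl.2 hv, ha⟩), rfl⟩
    · exact ⟨(v, u), mem_coe.2 (G.mem_interedges_iff.2 ⟨hu, mem_compl.2 hv, ha.symm⟩),
        Sym2.eq_swap⟩

theorem normLapLambdaOne_mul_vol_le_card_cutEdges [Nontrivial V] (hd : ∀ v, 0 < G.degree v)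
    (hpos : 0 < G.normLapLambdaOne) (S : Finset V) :
    G.normLapLambdaOne * ((∑ v ∈ S, (G.degree v : ℝ)) *
        (∑ v, (G.degree v : ℝ) - ∑ v ∈ S, (G.degree v : ℝ))) ≤
      (cutEdges G.edgeFinset S).card * ∑ v, (G.degree v : ℝ) := by
  rw [← G.card_interedges_compl]
  exact G.normLapLambdaOne_mul_vol_le hd hpos S

omit [DecidableEq V] in
theorem card_mul_minDegree_le_sum_degree (S : Finset V) :
    (S.card : ℝ) * G.minDegree ≤ ∑ v ∈ S, (G.degree v : ℝ) := by
  rw [← nsmul_eq_mul]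
  exact Finset.card_nsmul_le_sum _ _ _ fun v _ => by exact_mod_cast G.minDegree_le_degree v

/-- The second-smallest eigenvalue of the normalized Laplacian is at most `n / (n - 1)`. -/
theorem card_sub_one_mul_normLapLambdaOne_le [Nontrivial V] (hδ : 0 < G.minDegree)
    (hpos : 0 < G.normLapLambdaOne) :
    ((Fintype.card V : ℝ) - 1) * G.normLapLambdaOne ≤ Fintype.card V := by
  -- The cut around a vertex of minimum degree consists of its `δ` edges, whence `λ₁ (X - δ) ≤ X`;
  -- then `X ≥ nδ` is used.
  obtain ⟨v, hv⟩ := G.exists_minimal_degree_vertex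
  have h1 := G.normLapLambdaOne_mul_vol_le_card_cutEdges
    (fun v => hδ.trans_le (G.minDegree_le_degree v)) hpos {v}
  have h2 := G.sum_degree_eq_two_mul_card_innerEdges_add {v}
  rw [innerEdges_eq_empty (fun e he => G.not_isDiag_of_mem_edgeFinset he) (by simp)] at h2
  have h3 := G.card_mul_minDegree_le_sum_degree Finset.univ
  rw [Finset.card_univ] at h3
  simp only [Finset.sum_singleton, Finset.card_empty, mul_zero, zero_add, ← hv] at h1 h2
  rw [← h2] at h1
  have hδ' : (0 : ℝ) < G.minDegree := by exact_mod_cast hδ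
  set X := ∑ v, (G.degree v : ℝ)
  set lam := G.normLapLambdaOne
  have h4 : lam * (X - G.minDegree) ≤ X := by
    refine le_of_mul_le_mul_left ?_ hδ'
    linarith
  by_cases hl : lam ≤ 1
  · have : (1 : ℝ) ≤ Fintype.card V := by exact_mod_cast Fintype.card_pos
    nlinarith
  · refine le_of_mul_le_mul_left ?_ hδ'
    nlinarith

/-- A set of at most half of the total volume has many edges leaving it. -/
theorem normLapLambdaOne_mul_card_le_card_cutEdges [Nontrivial V] (hδ : 0 < G.minDegree)
    (hpos : 0 < G.normLapLambdaOne) (S : Finset V)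
    (hS : 2 * ∑ v ∈ S, (G.degree v : ℝ) ≤ ∑ v, (G.degree v : ℝ)) :
    (G.minDegree : ℝ) * G.normLapLambdaOne / 2 * S.card ≤
      (cutEdges G.edgeFinset S).card := by
  have hd : ∀ v, 0 < G.degree v := fun v => hδ.trans_le (G.minDegree_le_degree v)
  have h1 := G.normLapLambdaOne_mul_vol_le_card_cutEdges hd hpos S
  have h2 := G.card_mul_minDegree_le_sum_degree S
  have hX : 0 < ∑ v, (G.degree v : ℝ) :=
    Finset.sum_pos (fun v _ => by exact_mod_cast hd v) Finset.univ_nonempty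
  set X := ∑ v, (G.degree v : ℝ)
  set x := ∑ v ∈ S, (G.degree v : ℝ)
  set lam := G.normLapLambdaOne
  have hx : 0 ≤ x := le_trans (by positivity) h2
  have h3 : lam * x * X / 2 ≤ (cutEdges G.edgeFinset S).card * X := by
    nlinarith [mul_nonneg (mul_nonneg hpos.le hx) (sub_nonneg.2 hS)]
  refine le_of_mul_le_mul_right ?_ hX
  nlinarith [mul_nonneg (mul_nonneg hpos.le (sub_nonneg.2 h2)) hX.le]

end SimpleGraph

/-! ### Counting the colors that cross a partition -/

open Classical Finset in
/-- Merging colors as long as no class gets more than `M` elements: in the end, any two classes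
have more than `M` elements together. -/
theorem exists_merged_coloring {α κ : Type*} (E : Finset α) (c : α → κ) (M : ℝ)
    (hM : ∀ k, (#{e ∈ E | c e = k} : ℝ) ≤ M) :
    ∃ c' : α → κ, (∀ e f, c e = c f → c' e = c' f) ∧ (∀ k, (#{e ∈ E | c' e = k} : ℝ) ≤ M) ∧
      ∀ a ∈ E.image c', ∀ b ∈ E.image c', a ≠ b →
        M < #{e ∈ E | c' e = a} + #{e ∈ E | c' e = b} := by
  induction hn : #(E.image c) using Nat.strong_induction_on generalizing c with
  | _ n ih =>
  by_cases h : ∀ a ∈ E.image c, ∀ b ∈ E.image c, a ≠ b →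
      M < #{e ∈ E | c e = a} + #{e ∈ E | c e = b}
  · exact ⟨c, fun _ _ h => h, hM, h⟩
  · push Not at h
    obtain ⟨a, ha, b, hb, hab, hle⟩ := h
    set d : α → κ := fun e => if c e = b then a else c e with hd
    have hsub : E.image d ⊆ (E.image c).erase b := by
      intro k hk
      obtain ⟨e, he, rfl⟩ := mem_image.1 hk
      by_cases hc : c e = b
      · simp only [hd, hc, if_true]
        exact mem_erase.2 ⟨hab, ha⟩
      · simp only [hd, hc, if_false]
        exact mem_erase.2 ⟨hc, mem_image_of_mem _ he⟩
    have hlt : #(E.image d) < n := by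
      have := card_le_card hsub
      rw [card_erase_of_mem hb] at this
      have := card_pos.2 ⟨b, hb⟩
      omega
    have hdM : ∀ k, (#{e ∈ E | d e = k} : ℝ) ≤ M := by
      intro k
      by_cases hk : k = a
      · refine le_trans ?_ hle
        have : {e ∈ E | d e = k} ⊆ {e ∈ E | c e = a} ∪ {e ∈ E | c e = b} := by
          intro e
          simp only [hd, mem_filter, mem_union, hk]
          split_ifs with h <;> tauto
        exact_mod_cast (card_le_card this).trans (card_union_le _ _)
      · refine le_trans ?_ (hM k)
        have : {e ∈ E | d e = k} ⊆ {e ∈ E | c e = k} := by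
          intro e
          simp only [hd, mem_filter]
          split_ifs with h
          · rintro ⟨_, rfl⟩; exact absurd rfl hk
          · exact id
        exact_mod_cast card_le_card this
    obtain ⟨c', h1, h2, h3⟩ := ih _ hlt d hdM rfl
    refine ⟨c', fun e f hef => h1 e f ?_, h2, h3⟩
    simp only [hd, hef]

/-- The numbers `x q - δ` are nonnegative, so their squares sum to at most the square of their sum.
Equality holds when all but one of the `x q` equal `δ`. -/
theorem card_sub_one_mul_le_sq_sub_sum_sq {ι : Type*} [Fintype ι] (x : ι → ℝ) {δ : ℝ}
    (hx : ∀ q, δ ≤ x q) :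
    ((Fintype.card ι : ℝ) - 1) * δ * (2 * ∑ q, x q - Fintype.card ι * δ) ≤
      (∑ q, x q) ^ 2 - ∑ q, x q ^ 2 := by
  have h1 : ∑ q, (x q - δ) = ∑ q, x q - Fintype.card ι * δ := by
    simp [Finset.sum_sub_distrib]
  have h2 : ∑ q, (x q - δ) ^ 2 = ∑ q, x q ^ 2 - 2 * δ * ∑ q, x q + Fintype.card ι * δ ^ 2 := by
    simp only [sub_sq, Finset.sum_add_distrib, Finset.sum_sub_distrib, Finset.mul_sum]
    simp only [Finset.sum_const, Finset.card_univ, nsmul_eq_mul]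
    congr 2
    exact Finset.sum_congr rfl fun q _ => by ring
  have h3 : ∑ q, (x q - δ) ^ 2 ≤ (∑ q, (x q - δ)) ^ 2 :=
    Finset.sum_sq_le_sq_sum_of_nonneg fun q _ => sub_nonneg.2 (hx q)
  rw [h1, h2] at h3
  linarith

/-- The numerical core of the counting argument. A partition of `n` vertices into `s` parts is
crossed by `e` edges, `I` edges lie inside its parts; `EH` and `IH` are the corresponding numbers in
a random part of the graph that has density `p`, whose crossing edges have `c` colors; `B` colors
are nearly full. -/
theorem sub_two_lt_of_partition_bounds {n s δ lam X p e I EH IH c B : ℝ}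
    (hn : 2 ≤ n) (hs1 : 1 ≤ s) (hsn : s ≤ n) (hδ : 0 < δ) (hlam : 0 < lam) (hp : 0 < p)
    (hc : 0 ≤ c) (hI : 0 ≤ I)
    (hlam' : (n - 1) * lam ≤ n) (hX : n * δ ≤ X) (heI : e + I = X / 2)
    (he : δ * lam / 2 * ((s - 1) * (2 * X - s * δ)) ≤ e * X)
    (hI1 : 2 * I ≤ (n - s) * δ + (X - s * δ))
    (hI2 : ∀ φ : ℝ, 0 ≤ φ → 1 - lam + lam * (((n - s) * δ + (X - s * δ)) / X) ≤ φ →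
      2 * I ≤ φ * ((n - s) * δ + (X - s * δ)))
    (hEH : (1 - 2 / 10000) * (p * e) ≤ EH)
    (hEH' : EH ≤ c * ((1 + 2 / 10000) * (p * (δ * lam / 2))))
    (hIH : IH ≤ (1 + 1 / 10000) * (p * I) + 2 / 10000 * (n - s) * (p * (δ * lam / 2)))
    (hB : (B - c) * ((1 - 3 / 10000) * (p * (δ * lam / 2)) / 2) ≤ IH)
    (hXB : X / 2 ≤ B * (δ * lam / 2) + δ * lam / 2 / 2) :
    s - 2 < c := by
  have hXpos : 0 < X := lt_of_lt_of_le (by positivity) hX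
  have hlam2 : lam ≤ 2 := by nlinarith
  have hec : (1 - 2 / 10000) * e ≤ c * ((1 + 2 / 10000) * (δ * lam / 2)) := by
    refine le_of_mul_le_mul_left ?_ hp
    linarith
  -- Here the crossing edges exceed `(s - 1)M` by a factor `1 + 5/10000`, which outweighs the two
  -- sampling errors of `2/10000`.
  by_cases hA : s * δ ≤ (1 - 5 / 10000) * X
  · have h1 : δ * lam / 2 * ((s - 1) * (1 + 5 / 10000)) ≤ e := by
      refine le_of_mul_le_mul_right ?_ hXpos
      refine le_trans ?_ he
      have : (s - 1) * ((1 + 5 / 10000) * X) ≤ (s - 1) * (2 * X - s * δ) :=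
        mul_le_mul_of_nonneg_left (by linarith) (by linarith)
      nlinarith [mul_le_mul_of_nonneg_left this (show 0 ≤ δ * lam / 2 by positivity)]
    have h2 : (1 - 2 / 10000) * ((s - 1) * (1 + 5 / 10000)) ≤ c * (1 + 2 / 10000) := by
      refine le_of_mul_le_mul_left ?_ (show 0 < δ * lam / 2 by positivity)
      linarith
    linarith
  push Not at hA
  set W := (n - s) * δ + (X - s * δ) with hW
  have hWX : W ≤ 10 / 10000 * X := by rw [hW]; linarith
  have hW0 : 0 ≤ W := by linarith
  -- Almost all edges cross, at least about `nδ/2`, and a color covers about `δλ₁/2` of them. So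
  -- about `n/λ₁` colors are needed; `14` is just enough to exceed `n` after the errors.
  by_cases hB' : lam ≤ 1 - 14 / 10000
  · have h1 : (1 - 10 / 10000) * (X / 2) ≤ e := by linarith
    have h2 : (1 - 2 / 10000) * ((1 - 10 / 10000) * n) ≤ c * ((1 + 2 / 10000) * lam) := by
      refine le_of_mul_le_mul_left ?_ hδ
      linarith
    have h3 : c * ((1 + 2 / 10000) * lam) ≤ c * ((1 + 2 / 10000) * (1 - 14 / 10000)) := by
      gcongr
    linarith
  push Not at hB'
  -- `34 = 14 + 2 · 10`, from `1 - λ₁ < 14/10000`, `λ₁ ≤ 2` and `W/X ≤ 10/10000`.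
  have h1 : 2 * I ≤ 34 / 10000 * W := by
    refine hI2 _ (by norm_num) ?_
    have : W / X ≤ 10 / 10000 := by rw [div_le_iff₀ hXpos]; exact hWX
    have h0 : 0 ≤ W / X := by positivity
    linarith [mul_le_mul_of_nonneg_right hlam2 h0]
  have h2 : (B - c) * ((1 - 3 / 10000) * (δ * lam / 2) / 2) ≤
      (1 + 1 / 10000) * I + 2 / 10000 * (n - s) * (δ * lam / 2) := by
    refine le_of_mul_le_mul_left ?_ hp
    linarith
  -- `ζ` is the excess of the total degree over the `δ`-regular case, in units of `δ`.
  obtain ⟨ζ, hζ⟩ : ∃ ζ, ζ * δ = X - n * δ := ⟨(X - n * δ) / δ, by field_simp⟩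
  have hζ0 : 0 ≤ ζ := by
    by_contra h
    linarith [mul_neg_of_neg_of_pos (not_le.1 h) hδ]
  have hWζ : W = (2 * (n - s) + ζ) * δ := by rw [hW]; linarith
  have h3 : W ≤ (2 * (n - s) + ζ) * (4 * (δ * lam / 2)) := by
    rw [hWζ]
    refine mul_le_mul_of_nonneg_left ?_ (by linarith)
    linarith [mul_le_mul_of_nonneg_left hB'.le hδ.le]
  have h4 : (B - c) * ((1 - 3 / 10000) / 2) ≤
      (1 + 1 / 10000) * (17 / 10000 * ((2 * (n - s) + ζ) * 4)) + 2 / 10000 * (n - s) := by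
    refine le_of_mul_le_mul_right ?_ (show 0 < δ * lam / 2 by positivity)
    linarith
  have h5 : n + ζ ≤ (B + 1 / 2) * lam := by
    refine le_of_mul_le_mul_right ?_ hδ
    linarith
  have h6 : n - 1 + ζ / 2 ≤ B + 1 / 2 := by
    have hB0 : 0 < B + 1 / 2 := by
      by_contra h
      linarith [mul_nonpos_of_nonpos_of_nonneg (not_lt.1 h) hlam.le]
    have h7 : (n - 1) * (n + ζ) ≤ (B + 1 / 2) * n :=
      calc (n - 1) * (n + ζ) ≤ (n - 1) * ((B + 1 / 2) * lam) :=
            mul_le_mul_of_nonneg_left h5 (by linarith)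
        _ = (B + 1 / 2) * ((n - 1) * lam) := by ring
        _ ≤ _ := mul_le_mul_of_nonneg_left hlam' hB0.le
    refine le_of_mul_le_mul_right ?_ (show 0 < n by linarith)
    linarith [mul_nonneg hζ0 (sub_nonneg.2 hn)]
  -- `B ≥ n - 3/2 + ζ/2`, while `B - c` is at most a small multiple of `(n - s) + ζ`; hence `c ≥ s -
  -- 3/2`.
  linarith

set_option maxHeartbeats 1000000 in
open Classical Finset in
/-- If all cuts, all inner edge sets and all color classes of `G` have about the expected size in the
subgraph `H`, then `H` meets every partition into `s` classes in at least `s - 1` colors. -/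
theorem SimpleGraph.card_quotient_le_card_crossColors {V κ : Type*} [Fintype V]
    [DecidableEq V] [Nontrivial V]
    (G : SimpleGraph V) [DecidableRel G.Adj] (hδ : 0 < G.minDegree)
    (hpos : 0 < G.normLapLambdaOne) (c : Sym2 V → κ) {M p : ℝ}
    (hM : M = (G.minDegree : ℝ) * G.normLapLambdaOne / 2) (hp : 0 < p)
    (hcM : ∀ k, (#{e ∈ G.edgeFinset | c e = k} : ℝ) ≤ M)
    (hpair : ∀ a ∈ G.edgeFinset.image c, ∀ b ∈ G.edgeFinset.image c, a ≠ b →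
        M < #{e ∈ G.edgeFinset | c e = a} + #{e ∈ G.edgeFinset | c e = b})
    (H : Finset (Sym2 V)) (hH : H ⊆ G.edgeFinset)
    (hcut : ∀ S, (1 - 2 / 10000) * (p * #(cutEdges G.edgeFinset S)) ≤ #(cutEdges H S))
    (hinner : ∀ S, (#(innerEdges H S) : ℝ) ≤
      (1 + 1 / 10000) * (p * #(innerEdges G.edgeFinset S)) + 1 / 10000 * #S * (p * M))
    (hcolor : ∀ k, (#{e ∈ H | c e = k} : ℝ) ≤ (1 + 2 / 10000) * (p * M))
    (hbig : ∀ k, M < 2 * #{e ∈ G.edgeFinset | c e = k} →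
      (1 - 3 / 10000) * (p * M) / 2 ≤ #{e ∈ H | c e = k}) (s : Setoid V) :
    Nat.card (Quotient s) ≤ #(s.crossColors c H) + 1 := by
  have hd : ∀ v, 0 < G.degree v := fun v => hδ.trans_le (G.minDegree_le_degree v)
  have hδ' : (0 : ℝ) < G.minDegree := by exact_mod_cast hδ
  have hMpos : 0 < M := by rw [hM]; positivity
  rw [Nat.card_eq_fintype_card]
  set E := G.edgeFinset with hE
  set δ : ℝ := (G.minDegree : ℝ) with hδdef
  set lam := G.normLapLambdaOne with hlam
  set x : Quotient s → ℝ := fun q => ∑ v ∈ s.fiber q, (G.degree v : ℝ) with hx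
  set X := ∑ v, (G.degree v : ℝ) with hXdef
  have hXpos : 0 < X := Finset.sum_pos (fun v _ => by exact_mod_cast hd v) univ_nonempty
  have hxX : ∑ q, x q = X := by
    simp only [hx, hXdef, Setoid.fiber]
    exact sum_fiberwise _ _ _
  have haN : ∑ q, (#(s.fiber q) : ℝ) = Fintype.card V := by
    have := card_eq_sum_card_fiberwise (f := Quotient.mk s) (s := univ) (t := univ)
      (fun v _ => mem_univ _)
    rw [← card_univ, this]
    simp [Setoid.fiber]
  have ha1 : ∀ q, (1 : ℝ) ≤ #(s.fiber q) := fun q => by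
    exact_mod_cast card_pos.2 (s.fiber_nonempty q)
  have hxa : ∀ q, #(s.fiber q) * δ ≤ x q := fun q => G.card_mul_minDegree_le_sum_degree _
  have hcutq : ∀ q, lam * (x q * (X - x q)) ≤ #(cutEdges E (s.fiber q)) * X := fun q =>
    G.normLapLambdaOne_mul_vol_le_card_cutEdges hd hpos _
  have hdegq : ∀ q, x q = 2 * #(innerEdges E (s.fiber q)) + #(cutEdges E (s.fiber q)) :=
    fun q => by
      simp only [hx]
      exact_mod_cast G.sum_degree_eq_two_mul_card_innerEdges_add (s.fiber q)
  have hdiag : ∀ e ∈ E, ¬ e.IsDiag := fun e he => G.not_isDiag_of_mem_edgeFinset he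
  set e : ℝ := (#(E.filter s.Crosses) : ℝ) with he
  set I : ℝ := (#(E.filter fun e => ¬ s.Crosses e) : ℝ) with hI
  have hcutE : ∑ q, (#(cutEdges E (s.fiber q)) : ℝ) = 2 * e := by
    rw [he]; exact_mod_cast s.sum_card_cutEdges E
  have hinnE : ∑ q, (#(innerEdges E (s.fiber q)) : ℝ) = I := by
    rw [hI]; exact_mod_cast s.sum_card_innerEdges E
  have hcutH : ∑ q, (#(cutEdges H (s.fiber q)) : ℝ) = 2 * #(H.filter s.Crosses) := by
    exact_mod_cast s.sum_card_cutEdges H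
  have hinnH : ∑ q, (#(innerEdges H (s.fiber q)) : ℝ) = #(H.filter fun e => ¬ s.Crosses e) := by
    exact_mod_cast s.sum_card_innerEdges H
  have heI : e + I = X / 2 := by
    have : ∑ q, x q = 2 * I + 2 * e := by
      rw [← hcutE, ← hinnE, mul_sum, ← sum_add_distrib]
      exact sum_congr rfl fun q _ => hdegq q
    linarith
  have hsum1 : ∑ q : Quotient s, (1 : ℝ) = Fintype.card (Quotient s) := by simp
  have hxδ : ∀ q, δ ≤ x q := fun q => by
    linarith [hxa q, mul_nonneg (sub_nonneg.2 (ha1 q)) hδ'.le]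
  -- the volume of a class with more than one vertex
  set w : Quotient s → ℝ := fun q => (#(s.fiber q) - 1) * δ + (x q - δ) with hw
  have hw0 : ∀ q, 0 ≤ w q := fun q => by
    have := mul_nonneg (sub_nonneg.2 (ha1 q)) hδ'.le
    have := hxδ q
    simp only [hw]; linarith
  have hwsum : ∑ q, w q =
      ((Fintype.card V : ℝ) - Fintype.card (Quotient s)) * δ +
        (X - Fintype.card (Quotient s) * δ) := by
    simp only [hw, sum_add_distrib, sum_sub_distrib, ← sum_mul, hxX, haN, hsum1]
    simp
  set W := ∑ q, w q with hWdef
  have hwW : ∀ q, w q ≤ W := fun q => single_le_sum (fun q _ => hw0 q) (mem_univ q)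
  have hcases : ∀ q, innerEdges E (s.fiber q) = ∅ ∨
      (2 ≤ (#(s.fiber q) : ℝ) ∧ x q ≤ w q) := by
    intro q
    by_cases h : #(s.fiber q) ≤ 1
    · exact Or.inl (innerEdges_eq_empty hdiag h)
    · have h2 : (2 : ℝ) ≤ #(s.fiber q) := by exact_mod_cast not_le.1 h
      refine Or.inr ⟨h2, ?_⟩
      simp only [hw]
      linarith [mul_nonneg (sub_nonneg.2 h2) hδ'.le]
  have hcut0 : ∀ q, (0 : ℝ) ≤ #(cutEdges E (s.fiber q)) := fun q => by positivity
  have hI1 : 2 * I ≤ W := by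
    rw [← hinnE, hWdef, mul_sum]
    refine sum_le_sum fun q _ => ?_
    rcases hcases q with h | ⟨-, h⟩
    · simpa [h] using hw0 q
    · linarith [hdegq q, hcut0 q]
  -- Subtracting the spectral cut bound from the volume `x` of a class leaves at most `(1 - λ₁ + λ₁
  -- x/X) x` for twice its inner edges; singletons have none.
  have hI2 : ∀ φ : ℝ, 0 ≤ φ → 1 - lam + lam * (W / X) ≤ φ → 2 * I ≤ φ * W := by
    intro φ hφ hle
    rw [← hinnE, hWdef, mul_sum, mul_sum]
    refine sum_le_sum fun q _ => ?_
    rcases hcases q with h | ⟨-, h⟩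
    · simpa [h] using mul_nonneg hφ (hw0 q)
    · have hx0 : 0 ≤ x q := hδ'.le.trans (hxδ q)
      have h1 : lam * (x q * (1 - x q / X)) ≤ #(cutEdges E (s.fiber q)) := by
        refine le_of_mul_le_mul_right ?_ hXpos
        refine le_trans (le_of_eq ?_) (hcutq q)
        field_simp
      have h2 : x q / X ≤ W / X := by gcongr; exact h.trans (hwW q)
      have h3 : 1 - lam + lam * (x q / X) ≤ φ := by
        linarith [mul_le_mul_of_nonneg_left h2 hpos.le]
      calc 2 * (#(innerEdges E (s.fiber q)) : ℝ) ≤ (1 - lam + lam * (x q / X)) * x q := by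
            linarith [hdegq q]
        _ ≤ φ * x q := by gcongr
        _ ≤ φ * w q := by gcongr
  -- A class of size `a ≥ 2` has `a ≤ 2(a - 1)`, and singletons contribute nothing, so the additive
  -- errors sum to a multiple of `n - s`.
  have hIH : (#(H.filter fun e => ¬ s.Crosses e) : ℝ) ≤ (1 + 1 / 10000) * (p * I) +
      2 / 10000 * ((Fintype.card V : ℝ) - Fintype.card (Quotient s)) * (p * M) := by
    have hpM : 0 < p * M := by positivity
    have : (1 + 1 / 10000) * (p * I) +
        2 / 10000 * ((Fintype.card V : ℝ) - Fintype.card (Quotient s)) * (p * M) =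
        ∑ q, ((1 + 1 / 10000) * (p * (#(innerEdges E (s.fiber q)) : ℝ)) +
          2 / 10000 * ((#(s.fiber q) : ℝ) - 1) * (p * M)) := by
      rw [sum_add_distrib, ← mul_sum, ← mul_sum, ← sum_mul, ← mul_sum, sum_sub_distrib, hinnE, haN,
        hsum1]
    rw [this, ← hinnH]
    refine sum_le_sum fun q _ => ?_
    rcases hcases q with h | ⟨h, -⟩
    · have h' : innerEdges H (s.fiber q) = ∅ :=
        subset_empty.1 (h ▸ innerEdges_mono hH _)
      rw [h, h']
      have := mul_nonneg (sub_nonneg.2 (ha1 q)) hpM.le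
      simp only [card_empty, Nat.cast_zero]
      linarith
    · linarith [hinner (s.fiber q), mul_nonneg (sub_nonneg.2 h) hpM.le]
  have hEH : (1 - 2 / 10000) * (p * e) ≤ #(H.filter s.Crosses) := by
    have : ∑ q, (1 - 2 / 10000) * (p * (#(cutEdges E (s.fiber q)) : ℝ)) ≤
        ∑ q, (#(cutEdges H (s.fiber q)) : ℝ) := sum_le_sum fun q _ => hcut _
    rw [← mul_sum, ← mul_sum, hcutE, hcutH] at this
    linarith
  have hEH' : (#(H.filter s.Crosses) : ℝ) ≤
      #(s.crossColors c H) * ((1 + 2 / 10000) * (p * M)) := by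
    rw [card_eq_sum_card_image c, Nat.cast_sum, ← nsmul_eq_mul]
    refine sum_le_card_nsmul _ _ _ fun k _ => le_trans ?_ (hcolor k)
    exact_mod_cast card_le_card (filter_subset_filter _ (filter_subset _ _))
  set B := (E.image c).filter fun k => M < 2 * #{e ∈ E | c e = k} with hBdef
  -- By `hpair` at most one color has `M/2` edges or fewer.
  have hXB : X / 2 ≤ #B * M + M / 2 := by
    have h1 : X / 2 = ∑ k ∈ E.image c, (#{e ∈ E | c e = k} : ℝ) := by
      rw [← heI, he, hI, ← Nat.cast_add, card_filter_add_card_filter_not, card_eq_sum_card_image c,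
        Nat.cast_sum]
    rw [h1, ← sum_filter_add_sum_filter_not _ (fun k => M < 2 * #{e ∈ E | c e = k})]
    refine add_le_add ?_ ?_
    · rw [← nsmul_eq_mul]
      exact sum_le_card_nsmul _ _ _ fun k _ => hcM k
    · have h2 : #((E.image c).filter fun k => ¬ M < 2 * #{e ∈ E | c e = k}) ≤ 1 := by
        rw [card_le_one]
        intro a ha b hb
        rw [mem_filter] at ha hb
        by_contra hab
        have := hpair a ha.1 b hb.1 hab
        linarith
      have h3 : ((#((E.image c).filter fun k => ¬ M < 2 * #{e ∈ E | c e = k}) : ℕ) : ℝ) ≤ 1 := by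
        exact_mod_cast h2
      calc _ ≤ #((E.image c).filter fun k => ¬ M < 2 * #{e ∈ E | c e = k}) • (M / 2) :=
            sum_le_card_nsmul _ _ _ fun k hk => by
              have := (mem_filter.1 hk).2
              linarith
        _ ≤ M / 2 := by
            rw [nsmul_eq_mul]
            exact mul_le_of_le_one_left (by positivity) h3
  -- All edges in `H` of a large color that does not cross lie inside classes.
  have hB : ((#B : ℝ) - #(s.crossColors c H)) * ((1 - 3 / 10000) * (p * M) / 2) ≤
      #(H.filter fun e => ¬ s.Crosses e) := by
    have h1 : ((#B : ℝ) - #(s.crossColors c H)) ≤ #(B \ s.crossColors c H) := by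
      have := le_card_sdiff (s.crossColors c H) B
      rw [sub_le_iff_le_add]
      exact_mod_cast tsub_le_iff_right.1 this
    have h2 : ∀ k ∈ B \ s.crossColors c H, (1 - 3 / 10000) * (p * M) / 2 ≤
        (#{e ∈ H.filter (fun e => ¬ s.Crosses e) | c e = k} : ℝ) := by
      intro k hk
      obtain ⟨hkB, hkc⟩ := mem_sdiff.1 hk
      refine (hbig k (mem_filter.1 hkB).2).trans ?_
      have : {e ∈ H | c e = k} ⊆ {e ∈ H.filter (fun e => ¬ s.Crosses e) | c e = k} := by
        intro e he
        obtain ⟨he, hek⟩ := mem_filter.1 he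
        exact mem_filter.2 ⟨mem_filter.2 ⟨he, fun h => hkc
          (Setoid.mem_crossColors.2 ⟨e, he, h, hek⟩)⟩, hek⟩
      exact_mod_cast card_le_card this
    calc _ ≤ (#(B \ s.crossColors c H) : ℝ) * ((1 - 3 / 10000) * (p * M) / 2) :=
          mul_le_mul_of_nonneg_right h1 (by positivity)
      _ ≤ ∑ k ∈ B \ s.crossColors c H,
          (#{e ∈ H.filter (fun e => ¬ s.Crosses e) | c e = k} : ℝ) := by
          rw [← nsmul_eq_mul]
          exact card_nsmul_le_sum _ _ _ h2
      _ ≤ _ := by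
          rw [← Nat.cast_sum, Nat.cast_le]
          exact (sum_card_fiberwise_eq_card_filter _ _ c).le.trans
            (card_le_card (filter_subset _ _))
  have hn : (2 : ℝ) ≤ Fintype.card V := by exact_mod_cast Fintype.one_lt_card (α := V)
  have hs1 : (1 : ℝ) ≤ Fintype.card (Quotient s) := by
    exact_mod_cast Fintype.card_pos_iff.2 ⟨Quotient.mk s (Classical.arbitrary V)⟩
  have hsn : (Fintype.card (Quotient s) : ℝ) ≤ Fintype.card V := by
    exact_mod_cast Fintype.card_le_of_surjective _ Quotient.mk_surjective
  have hXn : (Fintype.card V : ℝ) * δ ≤ X := by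
    simpa using G.card_mul_minDegree_le_sum_degree univ
  have hbound : δ * lam / 2 * (((Fintype.card (Quotient s) : ℝ) - 1) *
      (2 * X - Fintype.card (Quotient s) * δ)) ≤ e * X := by
    have h1 := card_sub_one_mul_le_sq_sub_sum_sq x hxδ
    have h2 : ∑ q, lam * (x q * (X - x q)) ≤ ∑ q, (#(cutEdges E (s.fiber q)) : ℝ) * X :=
      sum_le_sum fun q _ => hcutq q
    have h3 : ∑ q, lam * (x q * (X - x q)) = lam * ((∑ q, x q) ^ 2 - ∑ q, x q ^ 2) := by
      rw [← mul_sum, sq, ← hxX]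
      congr 1
      simp only [mul_sub, sum_sub_distrib, ← sum_mul, sq]
    rw [h3, ← sum_mul, hcutE] at h2
    rw [hxX] at h1 h2
    have := mul_le_mul_of_nonneg_left h1 hpos.le
    linarith
  rw [hM] at hIH hEH' hXB hB
  have := sub_two_lt_of_partition_bounds hn hs1 hsn hδ' hpos hp (by positivity) (by positivity)
    (G.card_sub_one_mul_normLapLambdaOne_le hδ hpos) hXn heI hbound (hwsum ▸ hI1)
    (hwsum ▸ hI2) hEH hEH' hIH hB hXB
  have h' : ((Fintype.card (Quotient s) : ℕ) : ℝ) < ((#(s.crossColors c H) + 2 : ℕ) : ℝ) := by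
    push_cast; linarith
  have := Nat.cast_lt.1 h'
  omega

/-! ### The union bound -/

-- The binomial theorem gives `n r (1 + r)^n`, and `(1 + r)^n ≤ e`. The extra factor `r` remains
-- because only nonempty sets are encoded.
open Finset in
theorem sum_prod_finset_pow_le {V : Type*} [Fintype V] [DecidableEq V] {r : ℝ} (hr : 0 ≤ r)
    (hnr : Fintype.card V * r ≤ 1) :
    ∑ x : V × Finset V, r ^ (#x.2 + 1) ≤ 3 * Fintype.card V * r := by
  have h1 : ∑ S : Finset V, r ^ #S = (r + 1) ^ Fintype.card V := by
    rw [← Fintype.sum_pow_mul_eq_add_pow]; simp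
  have h2 : (r + 1) ^ Fintype.card V ≤ 3 :=
    calc (r + 1) ^ Fintype.card V ≤ Real.exp r ^ Fintype.card V := by
          gcongr; exact Real.add_one_le_exp r
      _ = Real.exp (Fintype.card V * r) := by rw [← Real.exp_nat_mul]
      _ ≤ Real.exp 1 := Real.exp_le_exp.2 hnr
      _ ≤ 3 := by linarith [Real.exp_one_lt_d9]
  rw [Fintype.sum_prod_type]
  simp only [pow_succ, ← sum_mul, h1, sum_const, card_univ, nsmul_eq_mul]
  nlinarith [mul_nonneg (Nat.cast_nonneg (α := ℝ) (Fintype.card V)) hr]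

open Classical Finset in
/-- The edges can be split into `t` parts in which all cuts, all inner edge sets and all color classes
have about the expected size. -/
theorem SimpleGraph.exists_balanced_edge_map {V κ : Type*} [Fintype V]
    [DecidableEq V] [Nontrivial V]
    (G : SimpleGraph V) [DecidableRel G.Adj] (hδ : 0 < G.minDegree)
    (hpos : 0 < G.normLapLambdaOne) (c : Sym2 V → κ) {M : ℝ}
    (hM : M = (G.minDegree : ℝ) * G.normLapLambdaOne / 2) {t : ℕ} (ht : 0 < t)
    (htn : t ≤ Fintype.card V)
    (hlog : 8 * Real.log (Fintype.card V) ≤ (1 / 10000) ^ 2 * ((t : ℝ)⁻¹ * M)) :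
    ∃ f : Sym2 V → Fin t, ∀ i,
      (∀ S, (1 - 2 / 10000) * ((t : ℝ)⁻¹ * #(cutEdges G.edgeFinset S)) ≤
        #(cutEdges {e ∈ G.edgeFinset | f e = i} S)) ∧
      (∀ S, (#(innerEdges {e ∈ G.edgeFinset | f e = i} S) : ℝ) ≤
        (1 + 1 / 10000) * ((t : ℝ)⁻¹ * #(innerEdges G.edgeFinset S)) +
          1 / 10000 * #S * ((t : ℝ)⁻¹ * M)) ∧
      ∀ k, |(#{e ∈ {e ∈ G.edgeFinset | f e = i} | c e = k} : ℝ) -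
        (t : ℝ)⁻¹ * #{e ∈ G.edgeFinset | c e = k}| ≤
          1 / 10000 * ((t : ℝ)⁻¹ * #{e ∈ G.edgeFinset | c e = k}) +
            1 / 10000 * ((t : ℝ)⁻¹ * M) := by
  have ht' : (0 : ℝ) < t := by exact_mod_cast ht
  have hδ' : (0 : ℝ) < G.minDegree := by exact_mod_cast hδ
  have hMpos : 0 < M := by rw [hM]; positivity
  set E := G.edgeFinset with hE
  set m := (t : ℝ)⁻¹ * M with hm
  have hmpos : 0 < m := by positivity
  set n := Fintype.card V with hn
  have hn2 : (2 : ℝ) ≤ n := by exact_mod_cast Fintype.one_lt_card (α := V)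
  set r := Real.exp (-((1 / 10000) ^ 2 * m)) with hr
  have hr0 : 0 < r := Real.exp_pos _
  have hrn : r * (n : ℝ) ^ 8 ≤ 1 := by
    have h1 : (n : ℝ) ^ 8 = Real.exp (8 * Real.log n) := by
      rw [mul_comm, Real.exp_mul, Real.exp_log (by linarith)]
      norm_cast
    rw [h1, hr, ← Real.exp_add, Real.exp_le_one_iff]
    linarith
  have hnr4 : 16 * (n : ℝ) ^ 3 * r ≤ 1 := by
    refine le_trans ?_ hrn
    have : (16 : ℝ) ≤ n ^ 5 := by
      calc (16 : ℝ) ≤ 2 ^ 5 := by norm_num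
        _ ≤ n ^ 5 := by gcongr
    calc 16 * (n : ℝ) ^ 3 * r ≤ n ^ 5 * n ^ 3 * r := by gcongr
      _ = r * (n : ℝ) ^ 8 := by ring
  have hnr1 : (n : ℝ) * r ≤ 1 := by
    refine le_trans ?_ hnr4
    have : (1 : ℝ) ≤ n ^ 2 := one_le_pow₀ (by linarith)
    have h2 : 0 ≤ (n : ℝ) * r := by positivity
    nlinarith
  have hcardSym : (Fintype.card (Sym2 V) : ℝ) ≤ n ^ 2 := by
    have h1 : Fintype.card (Sym2 V) ≤ Fintype.card (V × V) :=
      Fintype.card_le_of_surjective (fun p : V × V => s(p.1, p.2)) fun e => by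
        induction e with | _ u v => exact ⟨(u, v), rfl⟩
    rw [Fintype.card_prod, ← sq] at h1
    exact_mod_cast h1
  -- A pair `(v, S)` encodes a nonempty set, with repetitions. Colors are indexed by representative
  -- pairs of vertices, so the index type is finite even if `κ` is not.
  let A : (V × Finset V) ⊕ (V × Finset V) ⊕ Sym2 V → Finset (Sym2 V) :=
    Sum.elim (fun x => cutEdges E (insert x.1 x.2))
      (Sum.elim (fun x => innerEdges E (insert x.1 x.2)) fun e => {e' ∈ E | c e' = c e})
  let b : (V × Finset V) ⊕ (V × Finset V) ⊕ Sym2 V → ℝ :=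
    Sum.elim (fun x => 1 / 10000 * (#x.2 + 1) * m)
      (Sum.elim (fun x => 1 / 10000 * (#x.2 + 1) * m) fun _ => 1 / 10000 * m)
  have hexp : ∀ x : V × Finset V,
      Real.exp (-(1 / 10000 * (1 / 10000 * (#x.2 + 1) * m))) = r ^ (#x.2 + 1) := by
    intro x
    rw [hr, ← Real.exp_nat_mul]
    congr 1
    push_cast
    ring
  have hexp' : Real.exp (-(1 / 10000 * (1 / 10000 * m))) = r := by
    rw [hr]; congr 1; ring
  -- With `t ≤ n` and `r ≤ n⁻⁸`, the failure probability is at most `8 n³ r ≤ 1/2`.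
  have hsum : 2 * t * ∑ j, Real.exp (-(1 / 10000 * b j)) < 1 := by
    simp only [b, Fintype.sum_sum_type, Sum.elim_inl, Sum.elim_inr, hexp, hexp', sum_const,
      card_univ, nsmul_eq_mul]
    have h1 := sum_prod_finset_pow_le (V := V) hr0.le hnr1
    have h2 : (Fintype.card (Sym2 V) : ℝ) * r ≤ n ^ 2 * r := by gcongr
    have h3 : (t : ℝ) ≤ n := by exact_mod_cast htn
    have h4 : (n : ℝ) * r ≤ n ^ 2 * r / 2 := by
      have : 0 ≤ (n : ℝ) * r := by positivity
      nlinarith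
    calc _ ≤ 2 * (n : ℝ) * (3 * n * r + (3 * n * r + n ^ 2 * r)) := by gcongr
      _ ≤ 2 * (n : ℝ) * (4 * n ^ 2 * r) := by
          gcongr
          linarith
      _ = 16 * (n : ℝ) ^ 3 * r / 2 := by ring
      _ < 1 := by linarith
  obtain ⟨f, hf⟩ := exists_balanced_map ht A b (by norm_num) (by norm_num) hsum
  have hinsert : ∀ (S : Finset V) (v : V), v ∈ S → insert v (S.erase v) = S ∧
      ((#(S.erase v) : ℝ) + 1 = #S) := by
    intro S v hv
    refine ⟨insert_erase hv, ?_⟩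
    exact_mod_cast card_erase_add_one hv
  have hhalf : ∀ i S, 2 * ∑ v ∈ S, (G.degree v : ℝ) ≤ ∑ v, (G.degree v : ℝ) →
      (1 - 2 / 10000) * ((t : ℝ)⁻¹ * #(cutEdges E S)) ≤
        #(cutEdges {e ∈ E | f e = i} S) := by
    intro i S hS
    rcases S.eq_empty_or_nonempty with rfl | ⟨v, hv⟩
    · simp [cutEdges_empty]
    · have h1 := hf (Sum.inl (v, S.erase v)) i
      simp only [A, b, Sum.elim_inl] at h1
      rw [(hinsert S v hv).1, (hinsert S v hv).2, ← cutEdges_filter, div_eq_inv_mul] at h1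
      -- The cut has at least `M|S|` edges, so the additive error is at most another `1/10000` of
      -- the expected cut. Larger sets are handled by their complements.
      have h2 := G.normLapLambdaOne_mul_card_le_card_cutEdges hδ hpos S hS
      rw [← hM] at h2
      have h3 : #S * m ≤ (t : ℝ)⁻¹ * #(cutEdges E S) := by
        calc #S * m = (t : ℝ)⁻¹ * (M * #S) := by rw [hm]; ring
          _ ≤ _ := by gcongr
      linarith [(abs_le.1 h1).1]
  refine ⟨f, fun i => ⟨fun S => ?_, fun S => ?_, fun k => ?_⟩⟩
  · by_cases hS : 2 * ∑ v ∈ S, (G.degree v : ℝ) ≤ ∑ v, (G.degree v : ℝ)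
    · exact hhalf i S hS
    · have h1 := hhalf i Sᶜ (by
        rw [← sum_add_sum_compl S] at hS ⊢
        linarith)
      rwa [cutEdges_compl, cutEdges_compl] at h1
  · rcases S.eq_empty_or_nonempty with rfl | ⟨v, hv⟩
    · rw [innerEdges_eq_empty (fun e he => G.not_isDiag_of_mem_edgeFinset (mem_filter.1 he).1)
        (by simp)]
      simp only [card_empty, Nat.cast_zero]
      positivity
    · have h1 := hf (Sum.inr (Sum.inl (v, S.erase v))) i
      simp only [A, b, Sum.elim_inl, Sum.elim_inr] at h1
      rw [(hinsert S v hv).1, (hinsert S v hv).2, ← innerEdges_filter, div_eq_inv_mul] at h1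
      linarith [(abs_le.1 h1).2]
  · rw [filter_comm]
    by_cases hk : ∃ e, c e = k
    · obtain ⟨e, rfl⟩ := hk
      have h1 := hf (Sum.inr (Sum.inr e)) i
      simp only [A, b, Sum.elim_inr] at h1
      rwa [div_eq_inv_mul] at h1
    · push Not at hk
      simp only [hk, filter_false, filter_empty, card_empty, Nat.cast_zero, mul_zero, sub_zero,
        abs_zero, zero_add]
      positivity

/-! ### Assembling the trees -/

open Classical Finset in
/-- A spectral condition for `t` pairwise disjoint rainbow spanning trees. -/
theorem SimpleGraph.exists_disjoint_rainbow_trees {V κ : Type*} [Fintype V]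
    [DecidableEq V] [Nontrivial V]
    (G : SimpleGraph V) [DecidableRel G.Adj] (hδ : 0 < G.minDegree)
    (hpos : 0 < G.normLapLambdaOne) (c : Sym2 V → κ)
    (hc : ∀ k, (#{e ∈ G.edgeFinset | c e = k} : ℝ) ≤
      (G.minDegree : ℝ) * G.normLapLambdaOne / 2) {t : ℕ} (ht : 0 < t)
    (htn : t ≤ Fintype.card V)
    (hlog : 8 * Real.log (Fintype.card V) ≤
      (1 / 10000) ^ 2 * ((t : ℝ)⁻¹ * ((G.minDegree : ℝ) * G.normLapLambdaOne / 2))) :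
    ∃ T : Fin t → SimpleGraph V,
      (∀ i, T i ≤ G ∧ (T i).IsTree ∧ Set.InjOn c (T i).edgeSet) ∧
      Pairwise fun i j => Disjoint (T i).edgeSet (T j).edgeSet := by
  -- Merging coarsens the coloring, so a tree that is rainbow for `c'` is rainbow for `c`.
  obtain ⟨c', hc1, hc2, hc3⟩ := exists_merged_coloring G.edgeFinset c _ hc
  obtain ⟨f, hf⟩ := G.exists_balanced_edge_map hδ hpos c' rfl ht htn hlog
  have hp : (0 : ℝ) < (t : ℝ)⁻¹ := by positivity
  have htree : ∀ i, ∃ T : SimpleGraph V, T.IsTree ∧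
      T.edgeSet ⊆ ((G.edgeFinset.filter fun e => f e = i : Finset (Sym2 V)) : Set (Sym2 V)) ∧
      Set.InjOn c' T.edgeSet := by
    intro i
    obtain ⟨h1, h2, h3⟩ := hf i
    refine exists_isTree_injOn_of_crossColors c' _
      (G.card_quotient_le_card_crossColors hδ hpos c' rfl hp hc2 hc3 _ (filter_subset _ _) h1 h2
        (fun k => ?_) fun k hk => ?_)
    · have h4 := (abs_le.1 (h3 k)).2
      have h5 := mul_le_mul_of_nonneg_left (hc2 k) hp.le
      linarith
    · have h4 := (abs_le.1 (h3 k)).1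
      have h5 := mul_le_mul_of_nonneg_left hk.le hp.le
      linarith
  choose T hT1 hT2 hT3 using htree
  refine ⟨T, fun i => ⟨?_, hT1 i, fun e he e' he' h => hT3 i he he' (hc1 _ _ h)⟩, fun i j hij => ?_⟩
  · rw [← SimpleGraph.edgeSet_subset_edgeSet]
    intro e he
    exact G.mem_edgeFinset.1 (mem_filter.1 (mem_coe.1 (hT2 i he))).1
  · refine Set.disjoint_left.2 fun e hi hj => ?_
    exact hij ((mem_filter.1 (mem_coe.1 (hT2 i hi))).2.symm.trans
      (mem_filter.1 (mem_coe.1 (hT2 j hj))).2)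

theorem theorem1 :
    ∃ (C₀ : ℝ) (n₀ : ℕ), ∀ (C : ℝ), C₀ ≤ C →
      ∀ (V : Type*) [Fintype V] [DecidableEq V] [Nontrivial V], n₀ ≤ Fintype.card V →
      ∀ (G : SimpleGraph V) [DecidableRel G.Adj] (K : Type*) (χ : G.EdgeLabeling K),
        C * Real.log (Fintype.card V) ≤ (G.minDegree : ℝ) →
        (∀ k : K, ({e : G.edgeSet | χ e = k}.ncard : ℝ) ≤
          (G.minDegree : ℝ) * G.normLapLambdaOne / 2) →
        ∃ T : Fin ⌊(G.minDegree : ℝ) * G.normLapLambdaOne /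
              (C * Real.log (Fintype.card V))⌋₊ → SimpleGraph V,
          (∀ i, SimpleGraph.IsRainbowSpanningTree χ (T i)) ∧
          Pairwise fun i j => Disjoint (T i).edgeSet (T j).edgeSet := by
  classical
  -- The union bound needs `8 log n ≤ 10⁻⁸ δλ₁/(2t)`, and `δλ₁/t ≥ C log n`.
  refine ⟨16 * 10 ^ 8, 0, ?_⟩
  intro C hC V _ _ _ _ G _ K χ hdeg hcol
  set t := ⌊(G.minDegree : ℝ) * G.normLapLambdaOne / (C * Real.log (Fintype.card V))⌋₊ with ht
  -- For `t = 0` nothing is asked; `t ≥ 1` forces `λ₁ > 0`.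
  rcases Nat.eq_zero_or_pos t with h0 | htpos
  · rw [h0]
    exact ⟨fun i => i.elim0, fun i => i.elim0, fun i => i.elim0⟩
  have hn : (2 : ℝ) ≤ Fintype.card V := by exact_mod_cast Fintype.one_lt_card (α := V)
  have hL : 1 / 2 ≤ Real.log (Fintype.card V) := by
    have := Real.log_le_log (by norm_num) hn
    linarith [Real.log_two_gt_d9]
  set L := Real.log (Fintype.card V) with hLdef
  have hCL : 1 ≤ C * L := by nlinarith
  have hδ' : (0 : ℝ) < G.minDegree := by linarith
  have hδ : 0 < G.minDegree := by exact_mod_cast hδ'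
  have ht1 : (1 : ℝ) ≤ t := by exact_mod_cast htpos
  have htle : (t : ℝ) * (C * L) ≤ (G.minDegree : ℝ) * G.normLapLambdaOne := by
    rw [← le_div_iff₀ (by linarith)]
    exact Nat.floor_le (Nat.pos_of_floor_pos htpos).le
  have hpos : 0 < G.normLapLambdaOne := by
    refine pos_of_mul_pos_right (a := (G.minDegree : ℝ)) ?_ hδ'.le
    exact lt_of_lt_of_le (by positivity) htle
  have htn : t ≤ Fintype.card V := by
    have h1 := G.card_sub_one_mul_normLapLambdaOne_le hδ hpos
    have h2 : (G.minDegree : ℝ) ≤ Fintype.card V - 1 := by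
      have : G.minDegree + 1 ≤ Fintype.card V := G.minDegree_lt_card
      have : (G.minDegree : ℝ) + 1 ≤ Fintype.card V := by exact_mod_cast this
      linarith
    have h3 : (t : ℝ) ≤ Fintype.card V :=
      calc (t : ℝ) ≤ t * (C * L) := le_mul_of_one_le_right (by linarith) hCL
        _ ≤ (G.minDegree : ℝ) * G.normLapLambdaOne := htle
        _ ≤ (Fintype.card V - 1) * G.normLapLambdaOne := by gcongr
        _ ≤ _ := h1
    exact_mod_cast h3
  -- The value `none` is a dummy color for non-edges; no edge of `G` receives it.
  let c : Sym2 V → Option K := fun e => if h : e ∈ G.edgeSet then some (χ ⟨e, h⟩) else none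
  have hc : ∀ k, (({e ∈ G.edgeFinset | c e = k} : Finset (Sym2 V)).card : ℝ) ≤
      (G.minDegree : ℝ) * G.normLapLambdaOne / 2 := by
    intro k
    cases k with
    | none =>
      rw [Finset.filter_false_of_mem, Finset.card_empty, Nat.cast_zero]
      · positivity
      · intro e he
        simp [c, G.mem_edgeFinset.1 he]
    | some k =>
      refine le_trans (le_of_eq ?_) (hcol k)
      rw [← Set.ncard_image_of_injective _ Subtype.val_injective, ← Set.ncard_coe_finset]
      congr 2
      ext e
      simp only [Finset.coe_filter, SimpleGraph.mem_edgeFinset, Set.mem_ofPred_eq, Set.mem_image,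
        Subtype.exists, exists_and_right, exists_eq_right, c]
      constructor
      · rintro ⟨he, h⟩
        refine ⟨he, ?_⟩
        simpa [he] using h
      · rintro ⟨he, h⟩
        exact ⟨he, by simp [he, h]⟩
  have hlog : 8 * L ≤ (1 / 10000) ^ 2 *
      ((t : ℝ)⁻¹ * ((G.minDegree : ℝ) * G.normLapLambdaOne / 2)) := by
    have h1 : C * L ≤ (t : ℝ)⁻¹ * ((G.minDegree : ℝ) * G.normLapLambdaOne) := by
      rw [← div_eq_inv_mul, le_div_iff₀ (by linarith)]
      linarith
    have h2 : 16 * 10 ^ 8 * L ≤ C * L := by gcongr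
    linarith
  obtain ⟨T, hT, hdis⟩ := G.exists_disjoint_rainbow_trees hδ hpos c
    (fun k => by convert hc k) htpos htn hlog
  refine ⟨T, fun i => ⟨(hT i).1, (hT i).2.1, fun e f he hf hef => ?_⟩, hdis⟩
  refine Subtype.ext ((hT i).2.2 he hf ?_)
  simp only [c, e.2, f.2, dif_pos, hef]
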